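/- Let $p$ be a prime and let $G$ be a finite $p$-group. For an irreducible complex character $\chi$ of $G$, with kernel $\ker\chi=\{g\in G:\chi(g)=\chi(1)\}$, the codegree of $\chi$ is $|G:\ker\chi|/\chi(1)$; let $\mathrm{cod}(G)$ be the set of codegrees of all irreducible complex characters of $G$. The coclass of $G$ is $\log_p|G|-c$, where $c$ is the nilpotence class of $G$. (i) If $G$ has coclass $2$ and $|G|\ge p^5$, then $p^2\in\mathrm{cod}(G)$. (ii) If $G$ has coclass $3$ and $|G|\ge p^6$, then $p^2\in\mathrm{cod}(G)$. -/

import Mathlib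

noncomputable section

/-- `Irr(G)`: the complex irreducible characters of `G`, as functions `G → ℂ`. -/
def irreducibleCharacters (G : Type*) [Group G] : Set (G → ℂ) :=
  {χ | ∃ (n : ℕ) (ρ : Representation ℂ G (Fin n → ℂ)), ρ.IsIrreducible ∧ ρ.character = χ}

/-- The kernel of a character `χ`: the elements `g` with `χ(g) = χ(1)`. -/
def characterKernel {G : Type*} [Group G] (χ : G → ℂ) : Set G :=
  {g | χ g = χ 1}

/-- The codegree `|G : ker χ| / χ(1)` of a character `χ` of a finite group `G`. The division takes
place in `ℂ`, and the index of the kernel is written as `|G| / |ker χ|`. -/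
def codegree {G : Type*} [Group G] (χ : G → ℂ) : ℂ :=
  ((Nat.card G : ℂ) / (Nat.card (characterKernel χ) : ℂ)) / χ 1

/-- `cod(G)`: the set of codegrees of the irreducible characters of `G`. -/
def codegrees (G : Type*) [Group G] : Set ℂ :=
  codegree '' irreducibleCharacters G

/-- The coclass `log_p |G| - c` of a finite `p`-group `G` of nilpotence class `c`. For a finite
`p`-group `Nat.log p |G|` is the exact logarithm; the difference is taken in `ℤ`. -/
def coclass (p : ℕ) (G : Type*) [Group G] : ℤ :=
  (Nat.log p (Nat.card G) : ℤ) - (Group.nilpotencyClass G : ℤ)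

end

/-!
The codegrees of a quotient of `G` are codegrees of `G`, and `p ^ 2` is a codegree of the cyclic
group of order `p ^ 2` and of every nonabelian group of order `p ^ 3`, which has a faithful
irreducible character of degree `p`. So it suffices to find such a quotient.

If some `p`-th power lies outside `G' = commutator G`, the abelianization has a cyclic quotient of
order `p ^ 2`. Otherwise, after passing to a quotient, the third term `T` of the lower central
series is central of order `p`. If `G' ∩ Z(G)` has index at most `p` in `G'`, then the center of
`G / Z(G)` has exponent `p` and index `p ^ 2`, and the kernel of a character of that center which
is nontrivial on commutators gives a nonabelian quotient of order `p ^ 3`.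

If the index is larger, then `H = G / T`, whose order is at most `p ^ 5`, has order exactly `p ^ 5`
and `H' = Z(H)` has order `p ^ 2`. A quotient of `H` by a subgroup of order `p` of `H'` cannot have
a cyclic center of index `p ^ 3`, as the index would be the square of a character degree; this
produces an abelian maximal subgroup `D` of `H`. An element of order `p` in `D` outside `H'` yields
a nonabelian quotient of order `p ^ 3` again. If there is none, every element of `H'` is the `p`-th
power of an element of `D`, so the preimage of `D` in `G` centralizes `G'`, which forces the index
to be at most `p`.
-/

open scoped commutatorElement

section Representations

variable {k G V : Type*} [Field k] [Group G] [AddCommGroup V] [Module k V] [FiniteDimensional k V]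

theorem exists_coordinate_representation (σ : Representation k G V) :
    ∃ ρ : Representation k G (Fin (Module.finrank k V) → k),
      ∀ (g : G) (c : k), σ g = c • LinearMap.id → ρ g = c • LinearMap.id := by
  let e := (Module.finBasis k V).equivFun
  refine ⟨e.conjRingEquiv.toMonoidHom.comp σ, fun g c h => ?_⟩
  ext v i
  simp [h, LinearEquiv.conjRingEquiv]

theorem exists_isIrreducible_of_scalar [Nontrivial V] (σ : Representation k G V) (S : Set G)
    (l : S → k) (hσ : ∀ s : S, σ s = l s • LinearMap.id) :
    ∃ (n : ℕ) (ρ : Representation k G (Fin n → k)), ρ.IsIrreducible ∧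
      ∀ s : S, ρ s = l s • LinearMap.id := by
  classical
  have hex : ∃ n : ℕ, 0 < n ∧ ∃ ρ : Representation k G (Fin n → k),
      ∀ s : S, ρ s = l s • LinearMap.id := by
    obtain ⟨ρ, hρ⟩ := exists_coordinate_representation σ
    exact ⟨_, Module.finrank_pos, ρ, fun s => hρ s _ (hσ s)⟩
  -- A representation of minimal dimension among these has no proper subrepresentation.
  obtain ⟨hn, ρ, hρ⟩ := Nat.find_spec hex
  have hmin := fun m => Nat.find_min' hex (m := m)
  generalize Nat.find hex = n at hn ρ hρ hmin
  have : Nonempty (Fin n) := ⟨⟨0, hn⟩⟩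
  have : Nontrivial (Subrepresentation ρ) :=
    ⟨⊥, ⊤, fun h => bot_ne_top (congrArg Subrepresentation.toSubmodule h)⟩
  refine ⟨n, ρ, ⟨fun W => or_iff_not_imp_left.2 fun hW => ?_⟩, hρ⟩
  obtain ⟨τ, hτ⟩ := exists_coordinate_representation W.toRepresentation
  have hpos : 0 < Module.finrank k W.toSubmodule := by
    rw [pos_iff_ne_zero, ne_eq, Submodule.finrank_eq_zero]
    exact fun h => hW (Subrepresentation.toSubmodule_injective h)
  have hle : n ≤ Module.finrank k W.toSubmodule := hmin _ ⟨hpos, τ, fun s => hτ s _ (by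
    ext v i
    simp [Subrepresentation.toRepresentation, hρ s])⟩
  apply Subrepresentation.toSubmodule_injective
  apply Submodule.eq_top_of_finrank_eq
  exact le_antisymm (Submodule.finrank_le _) (by simpa using hle)

end Representations

section CentralCharacter

variable {k G : Type*} [Field k] [Group G] [Finite G]

theorem exists_isIrreducible_of_centralCharacter (l : Subgroup.center G →* kˣ) :
    ∃ (n : ℕ) (ρ : Representation k G (Fin n → k)), ρ.IsIrreducible ∧
      ∀ z : Subgroup.center G, ρ z = (l z : k) • LinearMap.id := by
  classical
  let φ := (Subgroup.center G).subtype
  let θ : Representation k (Subgroup.center G) k :=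
    (Module.toModuleEnd k (S := k) k).toMonoidHom.comp ((Units.coeHom k).comp l)
  let f : G → k := fun x => if h : x ∈ Subgroup.center G then l ⟨x, h⟩ else 0
  have hf : f ∈ Representation.coindV φ θ := fun z x => by
    by_cases hx : x ∈ Subgroup.center G
    · have hzx : (z : G) * x ∈ Subgroup.center G := mul_mem z.2 hx
      have : l ⟨z * x, hzx⟩ = l z * l ⟨x, hx⟩ := map_mul l z ⟨x, hx⟩
      simp [f, φ, θ, hx, hzx, this]
    · have hzx : (z : G) * x ∉ Subgroup.center G := by rwa [Subgroup.mul_mem_cancel_left _ z.2]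
      simp [f, φ, θ, hx, hzx]
  have : Nontrivial (Representation.coindV φ θ) := ⟨⟨f, hf⟩, 0, fun h => by
    simpa [f, one_mem] using congrFun (congrArg Subtype.val h) 1⟩
  have hcoind : ∀ z : Subgroup.center G,
      Representation.coind φ θ z = (l z : k) • LinearMap.id := fun z => by
    ext u x
    calc (Representation.coind φ θ z u).1 x = u.1 (x * z) := rfl
      _ = u.1 (φ z * x) := by rw [Subgroup.mem_center_iff.1 z.2 x]; rfl
      _ = θ z (u.1 x) := u.2 z x
  exact exists_isIrreducible_of_scalar (Representation.coind φ θ) (Subgroup.center G)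
    (fun z => (l z : k)) hcoind

end CentralCharacter

section FullyRamified

variable {G : Type*} [Group G]

theorem exists_injective_hom_units_of_isCyclic (A : Type*) [Group A] [Finite A] [IsCyclic A] :
    ∃ l : A →* ℂˣ, Function.Injective l := by
  have : NeZero (Nat.card A) := ⟨Nat.card_pos.ne'⟩
  let e : A ≃* rootsOfUnity (Nat.card A) ℂ := mulEquivOfCyclicCardEq
    (Complex.card_rootsOfUnity (Nat.card A)).symm
  exact ⟨(Subgroup.subtype _).comp e.toMonoidHom, Subtype.val_injective.comp e.injective⟩

variable {n : ℕ} {ρ : Representation ℂ G (Fin n → ℂ)} {l : Subgroup.center G →* ℂˣ}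

theorem character_coe_center (hs : ∀ z : Subgroup.center G, ρ z = (l z : ℂ) • LinearMap.id)
    (z : Subgroup.center G) : ρ.character z = l z * n := by
  simp [Representation.character, hs z]

theorem character_eq_zero_of_notMem_center (hcl : commutator G ≤ Subgroup.center G)
    (hs : ∀ z : Subgroup.center G, ρ z = (l z : ℂ) • LinearMap.id) (hl : Function.Injective l)
    {g : G} (hg : g ∉ Subgroup.center G) : ρ.character g = 0 := by
  obtain ⟨h, hne⟩ : ∃ h : G, ⁅h, g⁆ ≠ 1 := by
    by_contra! hcon
    exact hg (Subgroup.mem_center_iff.2 fun h => commutatorElement_eq_one_iff_mul_comm.1 (hcon h))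
  let z : Subgroup.center G := ⟨⁅h, g⁆, hcl (Subgroup.commutator_mem_commutator
    (Subgroup.mem_top h) (Subgroup.mem_top g))⟩
  have hconj : ρ.character g = l z * ρ.character g := by
    calc ρ.character g = ρ.character (h * g * h⁻¹) := (ρ.char_conj g h).symm
      _ = ρ.character (z * g) := by simp [z, commutatorElement_def]
      _ = l z * ρ.character g := by
        rw [Representation.character, map_mul, hs z]
        simp [Representation.character, Module.End.mul_eq_comp]
  by_contra h0
  have hlz : l z = 1 := Units.ext (mul_right_cancel₀ h0 (by simpa using hconj.symm))
  exact hne (congrArg Subtype.val (hl (hlz.trans (map_one l).symm)))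

theorem characterKernel_eq_singleton_one_of_injective (hn : n ≠ 0)
    (hs : ∀ z : Subgroup.center G, ρ z = (l z : ℂ) • LinearMap.id) (hl : Function.Injective l)
    (hzero : ∀ g ∉ Subgroup.center G, ρ.character g = 0) :
    characterKernel ρ.character = {1} := by
  have hn' : (n : ℂ) ≠ 0 := by exact_mod_cast hn
  refine Set.eq_singleton_iff_unique_mem.2 ⟨rfl, fun g (hg : ρ.character g = ρ.character 1) => ?_⟩
  rw [Representation.char_one, Module.finrank_fin_fun] at hg
  by_cases hgZ : g ∈ Subgroup.center G
  · have hlg : l ⟨g, hgZ⟩ = 1 := Units.ext <| mul_right_cancel₀ hn' <| by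
      rw [← character_coe_center hs, hg, Units.val_one, one_mul]
    exact congrArg Subtype.val (hl (hlg.trans (map_one l).symm))
  · exact absurd (hg.symm.trans (hzero g hgZ)) hn'

variable [Finite G]

theorem sq_eq_index_center_of_character_eq_zero (hρ : ρ.IsIrreducible)
    (hs : ∀ z : Subgroup.center G, ρ z = (l z : ℂ) • LinearMap.id)
    (hzero : ∀ g ∉ Subgroup.center G, ρ.character g = 0) :
    n ^ 2 = (Subgroup.center G).index := by
  classical
  have := Fintype.ofFinite G
  have : Invertible (Nat.card G : ℂ) := invertibleOfNonzero (by simp)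
  have horth := Representation.char_orthonormal ρ ρ
  rw [if_pos ⟨Representation.Equiv.refl ρ⟩] at horth
  have hterm : ∀ g : G,
      ρ.character g * ρ.character g⁻¹ = if g ∈ Subgroup.center G then (n : ℂ) ^ 2 else 0 := by
    intro g
    split_ifs with hg
    · have h1 := character_coe_center hs ⟨g, hg⟩
      have h2 := character_coe_center hs ⟨g, hg⟩⁻¹
      simp only [Subgroup.coe_inv, map_inv, Units.val_inv_eq_inv_val] at h1 h2
      rw [h1, h2]
      field_simp
    · rw [hzero g hg, zero_mul]
  have hsum : ∑ g : G, ρ.character g * ρ.character g⁻¹ =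
      (Nat.card (Subgroup.center G) : ℂ) * (n : ℂ) ^ 2 := by
    simp_rw [hterm]
    rw [← Finset.sum_filter, Finset.sum_const, nsmul_eq_mul, Nat.card_eq_fintype_card,
      Fintype.card_subtype]
  rw [hsum, ← (Subgroup.center G).card_mul_index] at horth
  have hZ0 : (Nat.card (Subgroup.center G) : ℂ) ≠ 0 := by exact_mod_cast Nat.card_pos.ne'
  have hI0 : ((Subgroup.center G).index : ℂ) ≠ 0 := by
    exact_mod_cast (Subgroup.center G).index_ne_zero_of_finite
  push_cast at horth
  field_simp at horth
  exact_mod_cast horth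

theorem exists_mem_codegrees_of_isCyclic_center [IsCyclic (Subgroup.center G)]
    (hcl : commutator G ≤ Subgroup.center G) :
    ∃ n : ℕ, n ^ 2 = (Subgroup.center G).index ∧
      (n * Nat.card (Subgroup.center G) : ℂ) ∈ codegrees G := by
  obtain ⟨l, hl⟩ := exists_injective_hom_units_of_isCyclic (Subgroup.center G)
  obtain ⟨n, ρ, hρ, hs⟩ := exists_isIrreducible_of_centralCharacter l
  have hzero : ∀ g ∉ Subgroup.center G, ρ.character g = 0 := fun g hg =>
    character_eq_zero_of_notMem_center hcl hs hl hg
  have hn : n ^ 2 = (Subgroup.center G).index := sq_eq_index_center_of_character_eq_zero hρ hs hzero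
  have hn0 : n ≠ 0 := by
    rintro rfl
    exact (Subgroup.center G).index_ne_zero_of_finite hn.symm
  refine ⟨n, hn, ρ.character, ⟨n, ρ, hρ, rfl⟩, ?_⟩
  have hn0' : (n : ℂ) ≠ 0 := by exact_mod_cast hn0
  rw [codegree, characterKernel_eq_singleton_one_of_injective hn0 hs hl hzero,
    ← (Subgroup.center G).card_mul_index, ← hn, Representation.char_one, Module.finrank_fin_fun]
  push_cast
  field_simp
  simp

end FullyRamified

section Inflation

variable {G H : Type*} [Group G] [Group H]

theorem card_preimage_of_surjective {f : G →* H} (hf : Function.Surjective f) (s : Set H) :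
    Nat.card (f ⁻¹' s) = Nat.card f.ker * Nat.card s := by
  have hσ := Function.surjInv_eq hf
  rw [← Nat.card_prod]
  exact Nat.card_congr
    { toFun := fun x => (⟨(Function.surjInv hf (f x))⁻¹ * x, by simp [MonoidHom.mem_ker, hσ]⟩,
        ⟨f x, x.2⟩)
      invFun := fun q => ⟨Function.surjInv hf q.2 * q.1, by
        simp [hσ, MonoidHom.mem_ker.1 q.1.2]⟩
      left_inv := fun x => by simp
      right_inv := fun q => by ext <;> simp [hσ, MonoidHom.mem_ker.1 q.1.2] }

variable [Finite G]

theorem codegrees_subset_of_surjective {f : G →* H} (hf : Function.Surjective f) :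
    codegrees H ⊆ codegrees G := by
  rintro _ ⟨_, ⟨n, ρ, hρ, rfl⟩, rfl⟩
  let τ : Representation ℂ G (Fin n → ℂ) := ρ.comp f
  refine ⟨τ.character, ⟨n, τ, ?_, rfl⟩, ?_⟩
  · let e : Subrepresentation ρ ≃o Subrepresentation τ :=
      { toFun := fun W => ⟨W.toSubmodule, fun g => W.apply_mem_toSubmodule (f g)⟩
        invFun := fun W => ⟨W.toSubmodule, hf.forall.2 fun g _ hv => W.apply_mem_toSubmodule g hv⟩
        left_inv := fun _ => rfl
        right_inv := fun _ => rfl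
        map_rel_iff' := Iff.rfl }
    exact e.isSimpleOrder_iff.1 hρ
  · have hτ : ∀ g, τ.character g = ρ.character (f g) := fun _ => rfl
    have hker : characterKernel τ.character = f ⁻¹' characterKernel ρ.character := by
      ext g
      simp [characterKernel, hτ]
    have hcard : Nat.card G = Nat.card f.ker * Nat.card H := by
      rw [← f.ker.card_mul_index, Subgroup.index_ker, MonoidHom.range_eq_top.2 hf,
        Subgroup.card_top]
    have hcard_ker : Nat.card (characterKernel τ.character) =
        Nat.card f.ker * Nat.card (characterKernel ρ.character) := by
      rw [hker, card_preimage_of_surjective hf]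
    have hker0 : (Nat.card f.ker : ℂ) ≠ 0 := by exact_mod_cast Nat.card_pos.ne'
    rw [codegree, codegree, hcard_ker, hτ, map_one, hcard]
    push_cast
    rw [mul_div_mul_left _ _ hker0]

end Inflation

section Commutators

variable {G : Type*} [Group G]

theorem commutatorElement_mem_commutator (x y : G) : ⁅x, y⁆ ∈ commutator G :=
  Subgroup.commutator_mem_commutator (Subgroup.mem_top _) (Subgroup.mem_top _)

theorem commutatorElement_mul_left_of_commute {a b c : G} (h : Commute a ⁅b, c⁆) :
    ⁅a * b, c⁆ = ⁅b, c⁆ * ⁅a, c⁆ := by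
  rw [commutatorElement_mul_left_eq_conj_mul, h.eq, mul_inv_cancel_right]

theorem commutatorElement_pow_left {z g : G} (h : Commute z ⁅z, g⁆) (n : ℕ) :
    ⁅z ^ n, g⁆ = ⁅z, g⁆ ^ n := by
  induction n with
  | zero => simp
  | succ n ih =>
    rw [pow_succ', commutatorElement_mul_left_of_commute (by rw [ih]; exact h.pow_right n), ih,
      pow_succ]

theorem commutatorElement_pow_right {z g : G} (h : Commute g ⁅z, g⁆) (n : ℕ) :
    ⁅z, g ^ n⁆ = ⁅z, g⁆ ^ n := by
  rw [← commutatorElement_inv, commutatorElement_pow_left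
    (by rw [← commutatorElement_inv]; exact h.inv_right), ← commutatorElement_inv z g, inv_pow,
    inv_inv]

theorem commute_of_mem_center {z : G} (hz : z ∈ Subgroup.center G) (g : G) : Commute g z :=
  Subgroup.mem_center_iff.1 hz g

theorem normal_of_le_center {N : Subgroup G} (h : N ≤ Subgroup.center G) : N.Normal := by
  rw [← Subgroup.commutator_top_right_le_iff,
    Subgroup.commutator_top_right_eq_bot_iff_le_center.2 h]
  exact bot_le

theorem commutator_quotient (N : Subgroup G) [N.Normal] :
    commutator (G ⧸ N) = (commutator G).map (QuotientGroup.mk' N) := by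
  rw [map_commutator_eq, MonoidHom.range_eq_top.2 (QuotientGroup.mk'_surjective N),
    commutator_def]

theorem commutator_quotient_eq_bot_iff (N : Subgroup G) [N.Normal] :
    commutator (G ⧸ N) = ⊥ ↔ commutator G ≤ N := by
  rw [commutator_quotient, Subgroup.map_eq_bot_iff, QuotientGroup.ker_mk']

theorem commute_mk_iff {N : Subgroup G} [N.Normal] {x g : G} :
    Commute (x : G ⧸ N) g ↔ ⁅x, g⁆ ∈ N := by
  rw [← commutatorElement_eq_one_iff_commute, ← QuotientGroup.eq_one_iff]
  rfl

theorem mk_mem_center_iff {N : Subgroup G} [N.Normal] {x : G} :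
    (x : G ⧸ N) ∈ Subgroup.center (G ⧸ N) ↔ ∀ g : G, ⁅x, g⁆ ∈ N := by
  rw [Subgroup.mem_center_iff, QuotientGroup.mk_surjective.forall]
  exact forall_congr' fun g => eq_comm.trans commute_mk_iff

theorem center_le_comap_center (N : Subgroup G) [N.Normal] :
    Subgroup.center G ≤ (Subgroup.center (G ⧸ N)).comap (QuotientGroup.mk' N) := fun _ hz =>
  mk_mem_center_iff.2 fun g =>
    commute_mk_iff.1 ((commute_of_mem_center hz g).symm.map (QuotientGroup.mk' N))

theorem card_mul_relIndex {H K : Subgroup G} (h : H ≤ K) :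
    Nat.card H * H.relIndex K = Nat.card K := by
  rw [← Subgroup.relIndex_bot_left, ← Subgroup.relIndex_bot_left,
    Subgroup.relIndex_mul_relIndex ⊥ H K bot_le h]

theorem index_map_mk'_eq {N H : Subgroup G} [N.Normal] (h : N ≤ H) :
    (H.map (QuotientGroup.mk' N)).index = H.index :=
  Subgroup.index_map_eq H (QuotientGroup.mk'_surjective N) (by rwa [QuotientGroup.ker_mk'])

theorem card_map_mk' (N H : Subgroup G) [N.Normal] :
    Nat.card (H.map (QuotientGroup.mk' N)) = N.relIndex H := by
  rw [← Subgroup.relIndex_ker, QuotientGroup.ker_mk']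

end Commutators

section Centralizers

variable {G : Type*} [Group G]

theorem relIndex_centralizer_singleton_le {A S : Subgroup G} [Finite S] {g : G}
    (hS : ∀ a ∈ A, ⁅a, g⁆ ∈ S) : (Subgroup.centralizer {g}).relIndex A ≤ Nat.card S := by
  refine Nat.card_le_card_of_injective
    (fun q : A ⧸ (Subgroup.centralizer {g}).subgroupOf A =>
      (⟨⁅(q.out : G), g⁆, hS _ q.out.2⟩ : S)) fun q r hqr => ?_
  have h : ⁅(q.out : G), g⁆ = ⁅(r.out : G), g⁆ := congrArg Subtype.val hqr
  rw [commutatorElement_def, commutatorElement_def, mul_left_inj] at h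
  rw [← q.out_eq', ← r.out_eq', QuotientGroup.eq, Subgroup.mem_subgroupOf,
    Subgroup.mem_centralizer_singleton_iff]
  have h2 := congrArg (fun t => (q.out : G)⁻¹ * t * r.out) h
  simp only [mul_assoc, inv_mul_cancel_left, inv_mul_cancel, mul_one] at h2
  simp only [Subgroup.coe_mul, Subgroup.coe_inv, mul_assoc]
  exact h2.symm

theorem relIndex_center_le [Finite G] {B D S : Subgroup G} {g : G}
    (hBD : D ≤ Subgroup.centralizer B) (hsup : D ⊔ Subgroup.zpowers g = ⊤)
    (hS : ∀ b ∈ B, ⁅b, g⁆ ∈ S) : (Subgroup.center G).relIndex B ≤ Nat.card S := by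
  have hle : Subgroup.centralizer {g} ⊓ B ≤ Subgroup.center G := by
    rintro b ⟨hbg, hbB⟩
    have htop : Subgroup.centralizer {b} = ⊤ := by
      rw [eq_top_iff, ← hsup, sup_le_iff, Subgroup.zpowers_le]
      exact ⟨hBD.trans (Subgroup.centralizer_le (Set.singleton_subset_iff.2 hbB)),
        Subgroup.mem_centralizer_singleton_iff.2
          (Subgroup.mem_centralizer_singleton_iff.1 hbg).symm⟩
    exact Subgroup.mem_center_iff.2 fun y =>
      Subgroup.mem_centralizer_singleton_iff.1 (htop ▸ Subgroup.mem_top y)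
  calc (Subgroup.center G).relIndex B
      ≤ (Subgroup.centralizer {g} ⊓ B).relIndex B :=
        Subgroup.relIndex_le_of_le_left hle Subgroup.index_ne_zero_of_finite
    _ = (Subgroup.centralizer {g}).relIndex B := Subgroup.inf_relIndex_right _ _
    _ ≤ Nat.card S := relIndex_centralizer_singleton_le hS

end Centralizers

section ClassTwo

variable {G : Type*} [Group G]

/-- The homomorphism `h ↦ ⁅h, g⁆` of a group of nilpotency class at most two. -/
def commutatorHom (hcl : commutator G ≤ Subgroup.center G) (g : G) : G →* G where
  toFun h := ⁅h, g⁆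
  map_one' := commutatorElement_one_left g
  map_mul' a b := by
    have h := fun x y => commute_of_mem_center (hcl (commutatorElement_mem_commutator x g)) y
    rw [commutatorElement_mul_left_of_commute (h b a), (h a _).eq]

theorem ker_commutatorHom (hcl : commutator G ≤ Subgroup.center G) (g : G) :
    (commutatorHom hcl g).ker = Subgroup.centralizer {g} := by
  ext h
  rw [MonoidHom.mem_ker, Subgroup.mem_centralizer_singleton_iff]
  exact commutatorElement_eq_one_iff_mul_comm

theorem card_range_commutatorHom (hcl : commutator G ≤ Subgroup.center G) (g : G) :
    Nat.card (commutatorHom hcl g).range = (Subgroup.centralizer {g}).index := by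
  rw [← ker_commutatorHom hcl, Subgroup.index_ker]

theorem range_commutatorHom_le (hcl : commutator G ≤ Subgroup.center G) (g : G) :
    (commutatorHom hcl g).range ≤ commutator G := by
  rintro _ ⟨h, rfl⟩
  exact commutatorElement_mem_commutator h g

theorem mk_mem_center_of_range_commutatorHom_le (hcl : commutator G ≤ Subgroup.center G)
    {N : Subgroup G} [N.Normal] {g : G} (h : (commutatorHom hcl g).range ≤ N) :
    (g : G ⧸ N) ∈ Subgroup.center (G ⧸ N) :=
  mk_mem_center_iff.2 fun x => by
    rw [← commutatorElement_inv]
    exact N.inv_mem (h ⟨x, rfl⟩)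

theorem pow_eq_one_of_mem_commutator (hcl : commutator G ≤ Subgroup.center G) {n : ℕ}
    (hpow : ∀ g : G, g ^ n ∈ Subgroup.center G) {h : G} (hh : h ∈ commutator G) : h ^ n = 1 := by
  rw [commutator_eq_closure] at hh
  induction hh using Subgroup.closure_induction with
  | mem x hx =>
    obtain ⟨a, b, rfl⟩ := hx
    have hc := commute_of_mem_center (hcl (commutatorElement_mem_commutator a b)) a
    rw [← commutatorElement_pow_left hc, commutatorElement_eq_one_iff_commute]
    exact (commute_of_mem_center (hpow a) b).symm
  | one => exact one_pow n
  | mul x y _ hy ihx ihy =>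
    rw [← commutator_eq_closure] at hy
    rw [(commute_of_mem_center (hcl hy) x).mul_pow, ihx, ihy, one_mul]
  | inv x _ ihx => rw [inv_pow, ihx, inv_one]

end ClassTwo

section SmallQuotients

variable {p : ℕ} [Fact p.Prime] {G : Type*} [Group G] [Finite G]

theorem sq_le_index_center (hG : IsPGroup p G) (hne : commutator G ≠ ⊥) :
    p ^ 2 ≤ (Subgroup.center G).index := by
  have hp : p.Prime := Fact.out
  obtain ⟨k, hk⟩ := hG.index (Subgroup.center G)
  rw [hk]
  refine Nat.pow_le_pow_right hp.pos ?_
  by_contra! hlt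
  apply hne
  interval_cases k
  · exact (commutator_eq_bot_iff_center_eq_top G).2 (Subgroup.index_eq_one.1 (by simpa using hk))
  · have : IsCyclic (G ⧸ Subgroup.center G) := isCyclic_of_prime_card (hk.trans (pow_one p))
    exact (commutator_eq_bot_iff G).2 (isMulCommutative_of_isCyclic_quotient_center_self G)

theorem card_mem_codegrees_of_isCyclic [IsCyclic G] : (Nat.card G : ℂ) ∈ codegrees G := by
  have hbot : commutator G = ⊥ := (commutator_eq_bot_iff G).2 IsCyclic.isMulCommutative
  have htop : Subgroup.center G = ⊤ := (commutator_eq_bot_iff_center_eq_top G).1 hbot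
  obtain ⟨n, hn, h⟩ := exists_mem_codegrees_of_isCyclic_center (hbot ▸ bot_le (a := _))
  rw [htop, Subgroup.index_top, Nat.pow_eq_one] at hn
  rw [htop, Subgroup.card_top] at h
  simpa [hn.resolve_right two_ne_zero] using h

theorem sq_mem_codegrees_of_card_eq_cube (hcard : Nat.card G = p ^ 3) (hne : commutator G ≠ ⊥) :
    (p : ℂ) ^ 2 ∈ codegrees G := by
  have hp : p.Prime := Fact.out
  have hG : IsPGroup p G := IsPGroup.of_card hcard
  obtain ⟨k, hk0, hk⟩ := IsPGroup.card_center_eq_prime_pow hcard (by norm_num)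
  have hmul := (Subgroup.center G).card_mul_index
  have hk1 : k = 1 := by
    have hle := Nat.mul_le_mul_left (p ^ k) (sq_le_index_center hG hne)
    rw [← hk, hmul, hcard, hk, ← pow_add, Nat.pow_le_pow_iff_right hp.one_lt] at hle
    omega
  have hcenter : Nat.card (Subgroup.center G) = p := by rw [hk, hk1, pow_one]
  have hidx : (Subgroup.center G).index = p ^ 2 := by
    rw [hcenter, hcard, pow_succ'] at hmul
    exact Nat.eq_of_mul_eq_mul_left hp.pos hmul
  have : IsCyclic (Subgroup.center G) := isCyclic_of_prime_card hcenter
  have hcl : commutator G ≤ Subgroup.center G :=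
    Subgroup.Normal.quotient_commutative_iff_commutator_le.1
      (IsPGroup.isMulCommutative_of_card_eq_prime_sq hidx)
  obtain ⟨n, hn, h⟩ := exists_mem_codegrees_of_isCyclic_center hcl
  rw [hidx] at hn
  rw [hcenter, Nat.pow_left_injective two_ne_zero hn, ← sq] at h
  exact h

theorem sq_mem_codegrees_of_pow_notMem_commutator (hG : IsPGroup p G) {g : G}
    (hg : g ^ p ∉ commutator G) : (p : ℂ) ^ 2 ∈ codegrees G := by
  have hp : p.Prime := Fact.out
  have : Finite (Abelianization G) := Finite.of_surjective _ QuotientGroup.mk_surjective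
  obtain ⟨φ, hφ⟩ := CommGroup.exists_apply_ne_one_of_hasEnoughRootsOfUnity (Abelianization G) ℂ
    (a := Abelianization.of (g ^ p)) (by rwa [ne_eq, ← MonoidHom.mem_ker, Abelianization.ker_of])
  let f : G →* ℂˣ := φ.comp Abelianization.of
  have : Finite f.range := Finite.of_surjective _ f.rangeRestrict_surjective
  obtain ⟨k, hk⟩ := IsPGroup.iff_card.1 (hG.of_surjective _ f.rangeRestrict_surjective)
  have hk2 : 2 ≤ k := by
    by_contra! hlt
    have hdvd : Nat.card f.range ∣ p := by
      rw [hk]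
      exact (pow_dvd_pow p (Nat.le_of_lt_succ hlt)).trans (pow_one p).dvd
    have hpow : f.rangeRestrict g ^ p = 1 :=
      orderOf_dvd_iff_pow_eq_one.1 ((orderOf_dvd_natCard _).trans hdvd)
    exact hφ ((map_pow f g p).trans (congrArg Subtype.val hpow))
  obtain ⟨K, hK⟩ := Sylow.exists_subgroup_card_pow_prime p (G := f.range)
    (hk ▸ pow_dvd_pow p (Nat.sub_le k 2))
  have hcard : Nat.card (f.range ⧸ K) = p ^ 2 := by
    have h := K.card_eq_card_quotient_mul_card_subgroup
    rw [hk, hK, ← pow_sub_mul_pow p hk2, mul_comm] at h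
    exact (Nat.eq_of_mul_eq_mul_right (Nat.pow_pos hp.pos) h.symm)
  have : IsCyclic (f.range ⧸ K) :=
    isCyclic_of_surjective (QuotientGroup.mk' K) (QuotientGroup.mk'_surjective K)
  have h := card_mem_codegrees_of_isCyclic (G := f.range ⧸ K)
  rw [hcard, Nat.cast_pow] at h
  exact codegrees_subset_of_surjective f.rangeRestrict_surjective
    (codegrees_subset_of_surjective (QuotientGroup.mk'_surjective K) h)

theorem card_range_eq_of_pow_eq_one {A k : Type*} [Group A] [Finite A] [Field k] {l : A →* kˣ}
    (hexp : ∀ x, l x ^ p = 1) {a : A} (ha : l a ≠ 1) : Nat.card l.range = p := by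
  have hp : p.Prime := Fact.out
  have : Finite l.range := Finite.of_surjective _ l.rangeRestrict_surjective
  have hdvd : Nat.card l.range ∣ p := by
    rw [← IsCyclic.exponent_eq_card, Monoid.exponent_dvd_iff_forall_pow_eq_one]
    rintro ⟨_, x, rfl⟩
    exact Subtype.ext (hexp x)
  refine ((Nat.dvd_prime hp).1 hdvd).resolve_left fun h => ha ?_
  exact Subgroup.mem_bot.1 (Subgroup.card_eq_one.1 h ▸ ⟨a, rfl⟩)

open scoped IsMulCommutative in
theorem sq_mem_codegrees_of_le_center (hG : IsPGroup p G) {M : Subgroup G}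
    (hM : M ≤ Subgroup.center G) (hexp : ∀ m ∈ M, m ^ p = 1) (hidx : M.index ≤ p ^ 2)
    (hne : commutator G ≠ ⊥) : (p : ℂ) ^ 2 ∈ codegrees G := by
  have hindex : M.index = p ^ 2 := le_antisymm hidx ((sq_le_index_center hG hne).trans
    (Subgroup.index_antitone hM))
  have : M.Normal := normal_of_le_center hM
  have hcl : commutator G ≤ M := Subgroup.Normal.quotient_commutative_iff_commutator_le.1
    (IsPGroup.isMulCommutative_of_card_eq_prime_sq hindex)
  obtain ⟨a, haG, ha1⟩ := (Subgroup.bot_or_exists_ne_one (commutator G)).resolve_left hne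
  obtain ⟨φ, hφ⟩ := CommGroup.exists_apply_ne_one_of_hasEnoughRootsOfUnity
    (Subgroup.center G) ℂ (a := ⟨a, hM (hcl haG)⟩) fun h => ha1 (congrArg Subtype.val h)
  let l : M →* ℂˣ := φ.comp (Subgroup.inclusion hM)
  let N : Subgroup G := l.ker.map M.subtype
  have hNM : N ≤ M := Subgroup.map_subtype_le l.ker
  have : N.Normal := normal_of_le_center (hNM.trans hM)
  have hrange : Nat.card l.range = p := card_range_eq_of_pow_eq_one
    (a := ⟨a, hcl haG⟩) (fun m => (map_pow l m p).symm.trans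
      ((congrArg l (Subtype.ext (hexp m m.2))).trans (map_one l))) hφ
  have hcard : Nat.card (G ⧸ N) = p ^ 3 := by
    rw [← Subgroup.index_eq_card, Subgroup.index_map_subtype, Subgroup.index_ker, hrange, hindex,
      ← pow_succ']
  have haN : a ∉ N := by
    rintro ⟨m, hm, rfl⟩
    exact hφ hm
  exact codegrees_subset_of_surjective (QuotientGroup.mk'_surjective N)
    (sq_mem_codegrees_of_card_eq_cube hcard fun h =>
      haN ((commutator_quotient_eq_bot_iff N).1 h haG))

end SmallQuotients

section PGroups

variable {p : ℕ} [Fact p.Prime] {G : Type*} [Group G] [Finite G]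

theorem card_mul_le_of_lt (hG : IsPGroup p G) {H K : Subgroup G} (h : H < K) :
    Nat.card H * p ≤ Nat.card K := by
  have hp : p.Prime := Fact.out
  obtain ⟨a, ha⟩ := IsPGroup.iff_card.1 (hG.to_subgroup H)
  obtain ⟨b, hb⟩ := IsPGroup.iff_card.1 (hG.to_subgroup K)
  have hlt : Nat.card H < Nat.card K := Set.Finite.card_lt_card (Set.toFinite _) h
  rw [ha, hb] at hlt ⊢
  rw [← pow_succ]
  exact Nat.pow_le_pow_right hp.pos ((Nat.pow_lt_pow_iff_right hp.one_lt).1 hlt)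

theorem index_mul_le_of_lt (hG : IsPGroup p G) {H K : Subgroup G} (h : H < K) :
    K.index * p ≤ H.index := by
  refine Nat.le_of_mul_le_mul_left ?_ (Nat.card_pos (α := H))
  calc Nat.card H * (K.index * p) = Nat.card H * p * K.index := by ring
    _ ≤ Nat.card K * K.index := Nat.mul_le_mul_right _ (card_mul_le_of_lt hG h)
    _ = Nat.card H * H.index := by rw [K.card_mul_index, H.card_mul_index]

theorem exists_between_card_mul (hG : IsPGroup p G) {R S : Subgroup G} (h : R < S) :
    ∃ N, R ≤ N ∧ N ≤ S ∧ Nat.card N * p = Nat.card S := by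
  have hp : p.Prime := Fact.out
  obtain ⟨a, ha⟩ := IsPGroup.iff_card.1 (hG.to_subgroup R)
  obtain ⟨b, hb⟩ := IsPGroup.iff_card.1 (hG.to_subgroup S)
  have hab := card_mul_le_of_lt hG h
  rw [ha, hb, ← pow_succ, Nat.pow_le_pow_iff_right hp.one_lt] at hab
  have hR : Nat.card (R.subgroupOf S) = p ^ a := by
    rw [← ha]
    exact Nat.card_congr (Subgroup.subgroupOfEquivOfLe h.le).toEquiv
  obtain ⟨K, hK, hRK⟩ := Sylow.exists_subgroup_card_pow_prime_le p (m := b - 1)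
    (hb ▸ pow_dvd_pow p (Nat.sub_le b 1)) (R.subgroupOf S) hR (by lia)
  refine ⟨K.map S.subtype, fun x hx => ⟨⟨x, h.le hx⟩, hRK hx, rfl⟩, Subgroup.map_subtype_le K, ?_⟩
  rw [Subgroup.card_map_of_injective S.subtype_injective, hK, hb, ← pow_succ,
    Nat.sub_add_cancel (by lia)]

theorem eq_of_lt_of_relIndex_le (hG : IsPGroup p G) {H K L : Subgroup G} (hHK : H < K)
    (hKL : K ≤ L) (h : H.relIndex L ≤ p) : K = L := by
  refine Subgroup.eq_of_le_of_card_ge hKL ?_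
  rw [← card_mul_relIndex (hHK.le.trans hKL)]
  exact (Nat.mul_le_mul_left _ h).trans (card_mul_le_of_lt hG hHK)

theorem exists_sup_zpowers_eq_top (hG : IsPGroup p G) {D : Subgroup G} (h : D.index ≤ p) :
    ∃ g, D ⊔ Subgroup.zpowers g = ⊤ := by
  by_cases hD : D = ⊤
  · exact ⟨1, by rw [hD, top_sup_eq]⟩
  · obtain ⟨g, -, hg⟩ := SetLike.exists_of_lt (lt_top_iff_ne_top.2 hD)
    refine ⟨g, eq_of_lt_of_relIndex_le hG (left_lt_sup.2 fun hle => hg ?_) le_top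
      (by rwa [Subgroup.relIndex_top_right])⟩
    exact hle (Subgroup.mem_zpowers g)

theorem le_centralizer_singleton_of_relIndex_center_le (hG : IsPGroup p G) {B : Subgroup G}
    (hrel : (Subgroup.center G).relIndex B ≤ p) {b c : G} (hb : b ∈ B)
    (hbZ : b ∉ Subgroup.center G) (hbc : Commute b c) : B ≤ Subgroup.centralizer {c} := by
  rw [← inf_eq_right]
  refine eq_of_lt_of_relIndex_le hG (H := Subgroup.center G ⊓ B) ?_ inf_le_right
    (by rwa [Subgroup.inf_relIndex_right])
  exact SetLike.lt_iff_le_and_exists.2 ⟨inf_le_inf_right B (Subgroup.center_le_centralizer _), b,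
    Subgroup.mem_inf.2 ⟨Subgroup.mem_centralizer_singleton_iff.2 hbc, hb⟩,
    fun h => hbZ (Subgroup.mem_inf.1 h).1⟩

end PGroups

section CentralQuotient

variable {p : ℕ} [Fact p.Prime] {G : Type*} [Group G] [Finite G]

theorem pow_mem_center_of_commutatorElement_mem_center (hG : IsPGroup p G)
    (hexp : ∀ g : G, g ^ p ∈ commutator G)
    (hrel : (Subgroup.center G).relIndex (commutator G) ≤ p) {z : G}
    (hz : ∀ g, ⁅z, g⁆ ∈ Subgroup.center G) : z ^ p ∈ Subgroup.center G := by
  by_contra hzp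
  have hle : commutator G ≤ Subgroup.centralizer {z} :=
    le_centralizer_singleton_of_relIndex_center_le hG hrel (hexp z) hzp (Commute.pow_self z p)
  refine hzp (Subgroup.mem_center_iff.2 fun g => Eq.symm ?_)
  have hcomm := commute_of_mem_center (hz g)
  rw [← commutatorElement_eq_one_iff_mul_comm]
  calc ⁅z ^ p, g⁆ = ⁅z, g⁆ ^ p := commutatorElement_pow_left (hcomm z) p
    _ = ⁅z, g ^ p⁆ := (commutatorElement_pow_right (hcomm g) p).symm
    _ = 1 := commutatorElement_eq_one_iff_mul_comm.2
        (Subgroup.mem_centralizer_singleton_iff.1 (hle (hexp g))).symm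

theorem index_center_le_of_le_centralizer {D : Subgroup G} (hG : IsPGroup p G)
    (hD : D ≤ Subgroup.centralizer D) (hidx : D.index ≤ p)
    (hcard : Nat.card (commutator G) ≤ p) : (Subgroup.center G).index ≤ p ^ 2 := by
  obtain ⟨g, hg⟩ := exists_sup_zpowers_eq_top hG hidx
  have hrel : (Subgroup.center G).relIndex D ≤ p := (relIndex_center_le hD hg fun b _ =>
    commutatorElement_mem_commutator b g).trans hcard
  calc (Subgroup.center G).index ≤ (Subgroup.center G ⊓ D).index :=
        Nat.le_of_dvd (Nat.pos_of_ne_zero Subgroup.index_ne_zero_of_finite)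
          (Subgroup.index_dvd_of_le inf_le_left)
    _ = (Subgroup.center G).relIndex D * D.index := by
      rw [← Subgroup.relIndex_mul_index (inf_le_right : Subgroup.center G ⊓ D ≤ D),
        Subgroup.inf_relIndex_right]
    _ ≤ p * p := Nat.mul_le_mul hrel hidx
    _ = p ^ 2 := (sq p).symm

theorem index_center_quotient_center_le (hG : IsPGroup p G)
    (hcard : Nat.card (⁅commutator G, (⊤ : Subgroup G)⁆ : Subgroup G) ≤ p)
    (hrel : (Subgroup.center G).relIndex (commutator G) ≤ p)
    (hne : ¬ commutator G ≤ Subgroup.center G) :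
    (Subgroup.center (G ⧸ Subgroup.center G)).index ≤ p ^ 2 := by
  obtain ⟨h, hhG, hhZ⟩ := SetLike.not_le_iff_exists.1 hne
  have hcent : Subgroup.centralizer {h} ≤ Subgroup.centralizer (commutator G) := fun c hc =>
    Subgroup.mem_centralizer_iff.2 fun x hx => Subgroup.mem_centralizer_singleton_iff.1 <|
      le_centralizer_singleton_of_relIndex_center_le hG hrel hhG hhZ
        (Subgroup.mem_centralizer_singleton_iff.1 hc).symm hx
  have hindex : (Subgroup.centralizer {h}).index ≤ p := by
    rw [← Subgroup.relIndex_top_right]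
    refine (relIndex_centralizer_singleton_le fun x _ => ?_).trans hcard
    rw [Subgroup.commutator_comm]
    exact Subgroup.commutator_mem_commutator (Subgroup.mem_top x) hhG
  refine index_center_le_of_le_centralizer (hG.to_quotient _)
    (D := (Subgroup.centralizer {h}).map (QuotientGroup.mk' (Subgroup.center G))) ?_ ?_ ?_
  · rw [← Subgroup.commutator_eq_bot_iff_le_centralizer, ← Subgroup.map_commutator,
      Subgroup.map_eq_bot_iff, QuotientGroup.ker_mk']
    exact (Subgroup.commutator_mono hcent hcent).trans
      (commutator_centralizer_commutator_le_center G)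
  · rwa [index_map_mk'_eq (Subgroup.center_le_centralizer _)]
  · rwa [commutator_quotient, card_map_mk']

theorem sq_mem_codegrees_of_relIndex_center_le (hG : IsPGroup p G)
    (hexp : ∀ g : G, g ^ p ∈ commutator G)
    (hcard : Nat.card (⁅commutator G, (⊤ : Subgroup G)⁆ : Subgroup G) ≤ p)
    (hrel : (Subgroup.center G).relIndex (commutator G) ≤ p)
    (hne : ¬ commutator G ≤ Subgroup.center G) : (p : ℂ) ^ 2 ∈ codegrees G := by
  refine codegrees_subset_of_surjective (QuotientGroup.mk'_surjective (Subgroup.center G))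
    (sq_mem_codegrees_of_le_center (hG.to_quotient _) le_rfl ?_
      (index_center_quotient_center_le hG hcard hrel hne)
      (mt (commutator_quotient_eq_bot_iff _).1 hne))
  refine QuotientGroup.mk_surjective.forall.2 fun z hz => ?_
  rw [← QuotientGroup.mk_pow, QuotientGroup.eq_one_iff]
  exact pow_mem_center_of_commutatorElement_mem_center hG hexp hrel (mk_mem_center_iff.1 hz)

end CentralQuotient

section ClassTwoPGroups

variable {p : ℕ} [Fact p.Prime] {G : Type*} [Group G] [Finite G]

theorem cube_le_index_center (hG : IsPGroup p G) (hcl : commutator G ≤ Subgroup.center G)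
    (hcard : p < Nat.card (commutator G)) : p ^ 3 ≤ (Subgroup.center G).index := by
  have hp : p.Prime := Fact.out
  obtain ⟨k, hk⟩ := hG.index (Subgroup.center G)
  rw [hk]
  refine Nat.pow_le_pow_right hp.pos ?_
  by_contra! hlt
  have hidx : (Subgroup.center G).index ≤ p * p :=
    hk.trans_le ((Nat.pow_le_pow_right hp.pos (Nat.le_of_lt_succ hlt)).trans_eq (sq p))
  obtain ⟨g, -, hg⟩ : ∃ g ∈ (⊤ : Subgroup G), g ∉ Subgroup.center G :=
    SetLike.not_le_iff_exists.1 fun htop => by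
      rw [(commutator_eq_bot_iff_center_eq_top G).2 (top_le_iff.1 htop), Subgroup.card_bot] at hcard
      exact hp.one_lt.not_gt hcard
  let R := (commutatorHom hcl g).range
  have hRZ : R ≤ Subgroup.center G := (range_commutatorHom_le hcl g).trans hcl
  have : R.Normal := normal_of_le_center hRZ
  have hR : Nat.card R ≤ p := by
    rw [card_range_commutatorHom hcl]
    refine Nat.le_of_mul_le_mul_right ((index_mul_le_of_lt hG ?_).trans hidx) hp.pos
    exact SetLike.lt_iff_le_and_exists.2 ⟨Subgroup.center_le_centralizer _, g,
      Subgroup.mem_centralizer_singleton_iff.2 rfl, hg⟩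
  have hquot : (Subgroup.center (G ⧸ R)).index ≤ p := by
    rw [← Subgroup.index_comap_of_surjective _ (QuotientGroup.mk'_surjective R)]
    refine Nat.le_of_mul_le_mul_right ((index_mul_le_of_lt hG ?_).trans hidx) hp.pos
    exact SetLike.lt_iff_le_and_exists.2 ⟨center_le_comap_center R, g,
      mk_mem_center_of_range_commutatorHom_le hcl le_rfl, hg⟩
  have hbot : commutator (G ⧸ R) = ⊥ := by
    by_contra hne
    exact (hquot.trans_lt (lt_self_pow₀ hp.one_lt one_lt_two)).not_ge
      (sq_le_index_center (hG.to_quotient R) hne)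
  exact hcard.not_ge
    ((Subgroup.card_le_of_le ((commutator_quotient_eq_bot_iff R).1 hbot)).trans hR)

theorem commutator_eq_center_of_card_le (hG : IsPGroup p G)
    (hcl : commutator G ≤ Subgroup.center G) (hcard : p < Nat.card (commutator G))
    (hle : Nat.card G ≤ p ^ 5) :
    commutator G = Subgroup.center G ∧ Nat.card (Subgroup.center G) = p ^ 2 ∧
      (Subgroup.center G).index = p ^ 3 := by
  have hp : p.Prime := Fact.out
  have hindex : p ^ 3 ≤ (Subgroup.center G).index := cube_le_index_center hG hcl hcard
  have hcomm : p ^ 2 ≤ Nat.card (commutator G) := by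
    obtain ⟨k, hk⟩ := IsPGroup.iff_card.1 (hG.to_subgroup (commutator G))
    rw [hk] at hcard ⊢
    exact Nat.pow_le_pow_right hp.pos
      ((Nat.pow_lt_pow_iff_right hp.one_lt).1 ((pow_one p).trans_lt hcard))
  have hmul : Nat.card (Subgroup.center G) * (Subgroup.center G).index ≤ p ^ 2 * p ^ 3 := by
    rwa [Subgroup.card_mul_index, ← pow_add]
  have hcenter : Nat.card (Subgroup.center G) ≤ p ^ 2 :=
    Nat.le_of_mul_le_mul_right ((Nat.mul_le_mul_left _ hindex).trans hmul) (pow_pos hp.pos 3)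
  have heq := Subgroup.eq_of_le_of_card_ge hcl (hcenter.trans hcomm)
  have hge : p ^ 2 ≤ Nat.card (Subgroup.center G) := heq ▸ hcomm
  exact ⟨heq, hcenter.antisymm hge, hindex.antisymm'
    (Nat.le_of_mul_le_mul_left ((Nat.mul_le_mul_right _ hge).trans hmul) (pow_pos hp.pos 2))⟩

theorem exists_notMem_commutator_forall_commutatorElement_mem
    (hcl : commutator G ≤ Subgroup.center G) (hidx : (commutator G).index = p ^ 3)
    {N : Subgroup G} (hN : N ≤ commutator G) (hcard : Nat.card N * p = Nat.card (commutator G)) :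
    ∃ x ∉ commutator G, ∀ g, ⁅x, g⁆ ∈ N := by
  have hp : p.Prime := Fact.out
  have : N.Normal := normal_of_le_center (hN.trans hcl)
  have hQcl : commutator (G ⧸ N) ≤ Subgroup.center (G ⧸ N) := by
    rw [commutator_quotient, Subgroup.map_le_iff_le_comap]
    exact hcl.trans (center_le_comap_center N)
  by_contra! hcon
  have hcenter : Subgroup.center (G ⧸ N) = commutator (G ⧸ N) := by
    refine le_antisymm (QuotientGroup.mk_surjective.forall.2 fun x hx => ?_) hQcl
    rw [commutator_quotient]
    by_contra hxG
    obtain ⟨g, hg⟩ := hcon x fun h => hxG ⟨x, h, rfl⟩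
    exact hg (mk_mem_center_iff.1 hx g)
  have hcard_center : Nat.card (Subgroup.center (G ⧸ N)) = p := by
    rw [hcenter, commutator_quotient, card_map_mk']
    exact Nat.eq_of_mul_eq_mul_left Nat.card_pos ((card_mul_relIndex hN).trans hcard.symm)
  have : IsCyclic (Subgroup.center (G ⧸ N)) := isCyclic_of_prime_card hcard_center
  obtain ⟨n, hn, -⟩ := exists_mem_codegrees_of_isCyclic_center hQcl
  rw [hcenter, commutator_quotient, index_map_mk'_eq hN, hidx] at hn
  have hparity : 2 * n.factorization p = 3 := by
    have h := congrArg (fun m => m.factorization p) hn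
    simpa [hp.factorization] using h
  lia

theorem centralizer_singleton_le_centralizer (hG : IsPGroup p G) {x : G}
    (hx : x ∉ Subgroup.center G)
    (h : (Subgroup.center G).relIndex (Subgroup.centralizer {x}) ≤ p ^ 2) :
    Subgroup.centralizer {x} ≤ Subgroup.centralizer (Subgroup.centralizer {x} : Set G) := by
  have hp : p.Prime := Fact.out
  set D := Subgroup.centralizer {x}
  have hD : IsPGroup p D := hG.to_subgroup D
  have hlt : (Subgroup.center G).subgroupOf D < Subgroup.center D := by
    refine SetLike.lt_iff_le_and_exists.2 ⟨fun z hz => Subgroup.mem_center_iff.2 fun d =>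
      Subtype.ext (commute_of_mem_center hz d),
      ⟨x, Subgroup.mem_centralizer_singleton_iff.2 rfl⟩, ?_, hx⟩
    exact Subgroup.mem_center_iff.2 fun d =>
      Subtype.ext (Subgroup.mem_centralizer_singleton_iff.1 d.2)
  have hidx : (Subgroup.center D).index ≤ p :=
    Nat.le_of_mul_le_mul_right ((index_mul_le_of_lt hD hlt).trans (h.trans_eq (sq p))) hp.pos
  rw [Subgroup.le_centralizer_iff_isMulCommutative, ← commutator_eq_bot_iff]
  by_contra hne
  exact (hidx.trans_lt (lt_self_pow₀ hp.one_lt one_lt_two)).not_ge (sq_le_index_center hD hne)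

theorem exists_le_centralizer_of_index_eq (hG : IsPGroup p G)
    (heq : commutator G = Subgroup.center G) (hcard : Nat.card (Subgroup.center G) = p ^ 2)
    (hidx : (Subgroup.center G).index = p ^ 3) :
    ∃ D : Subgroup G, D.index = p ∧ D ≤ Subgroup.centralizer D := by
  have hp : p.Prime := Fact.out
  obtain ⟨N, -, hN, hNcard⟩ := exists_between_card_mul hG (R := ⊥) (S := commutator G) <| by
    rw [bot_lt_iff_ne_bot, heq, ne_eq, ← Subgroup.card_eq_one, hcard]
    exact (one_lt_pow₀ hp.one_lt two_ne_zero).ne'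
  have hNp : Nat.card N = p := by
    rw [heq, hcard, sq] at hNcard
    exact Nat.eq_of_mul_eq_mul_right hp.pos hNcard
  obtain ⟨x, hx, hxN⟩ :=
    exists_notMem_commutator_forall_commutatorElement_mem heq.le (heq ▸ hidx) hN hNcard
  rw [heq] at hx
  let D := Subgroup.centralizer {x}
  have hD : D.index = p := by
    refine le_antisymm ?_ ?_
    · rw [← Subgroup.relIndex_top_right, ← hNp]
      refine relIndex_centralizer_singleton_le fun y _ => ?_
      rw [← commutatorElement_inv]
      exact N.inv_mem (hxN y)
    · have hlt : D < ⊤ := lt_top_iff_ne_top.2 fun h => hx <| by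
        exact Set.singleton_subset_iff.1 (Subgroup.centralizer_eq_top_iff_subset.1 h)
      simpa using index_mul_le_of_lt hG hlt
  refine ⟨D, hD, centralizer_singleton_le_centralizer hG hx ?_⟩
  have hmul := Subgroup.relIndex_mul_index (Subgroup.center_le_centralizer {x})
  rw [hD, hidx, pow_succ] at hmul
  exact (Nat.eq_of_mul_eq_mul_right hp.pos hmul).le

theorem sq_mem_codegrees_of_pow_eq_one (hG : IsPGroup p G)
    (hcl : commutator G ≤ Subgroup.center G) (hexp : ∀ h ∈ commutator G, h ^ p = 1)
    (hcard : p < Nat.card (commutator G)) (hidx : (commutator G).index ≤ p ^ 3) {D : Subgroup G}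
    (hDidx : D.index ≤ p) (hD : D ≤ Subgroup.centralizer D) {d : G} (hdD : d ∈ D)
    (hd : d ∉ commutator G) (hdp : d ^ p = 1) : (p : ℂ) ^ 2 ∈ codegrees G := by
  have hp : p.Prime := Fact.out
  let R := (commutatorHom hcl d).range
  have : R.Normal := normal_of_le_center ((range_commutatorHom_le hcl d).trans hcl)
  have hR : Nat.card R ≤ p := by
    rw [card_range_commutatorHom hcl]
    refine le_trans (Subgroup.index_antitone fun x hx => ?_) hDidx
    exact Subgroup.mem_centralizer_singleton_iff.2 (Subgroup.mem_centralizer_iff.1 (hD hdD) x hx)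
  let S := commutator G ⊔ Subgroup.zpowers d
  have hRS : R ≤ S := (range_commutatorHom_le hcl d).trans le_sup_left
  have hSexp : ∀ s ∈ S, s ^ p = 1 := by
    intro s hs
    obtain ⟨h, hh, _, ⟨k, rfl⟩, rfl⟩ := Subgroup.mem_sup_of_normal_left.1 hs
    rw [(commute_of_mem_center (hcl hh) (d ^ k)).symm.mul_pow, hexp h hh, one_mul, ← zpow_natCast,
      zpow_comm, zpow_natCast, hdp, one_zpow]
  have hSidx : S.index ≤ p ^ 2 := by
    have hlt : commutator G < S :=
      left_lt_sup.2 fun hle => hd (hle (Subgroup.mem_zpowers d))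
    exact Nat.le_of_mul_le_mul_right
      ((index_mul_le_of_lt hG hlt).trans (hidx.trans_eq (pow_succ p 2))) hp.pos
  refine codegrees_subset_of_surjective (QuotientGroup.mk'_surjective R)
    (sq_mem_codegrees_of_le_center (hG.to_quotient R) (M := S.map (QuotientGroup.mk' R))
      ?_ ?_ ?_ ?_)
  · rw [Subgroup.map_le_iff_le_comap, sup_le_iff, Subgroup.zpowers_le]
    exact ⟨hcl.trans (center_le_comap_center R),
      mk_mem_center_of_range_commutatorHom_le hcl le_rfl⟩
  · rintro _ ⟨s, hs, rfl⟩
    rw [← map_pow, hSexp s hs, map_one]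
  · rwa [index_map_mk'_eq hRS]
  · rw [ne_eq, commutator_quotient_eq_bot_iff]
    exact fun hle => hcard.not_ge ((Subgroup.card_le_of_le hle).trans hR)

open scoped IsMulCommutative in
theorem exists_pow_eq_of_le_centralizer {D C : Subgroup G} (hD : D ≤ Subgroup.centralizer D)
    {n : ℕ} (hpow : ∀ d ∈ D, d ^ n ∈ C) (hker : ∀ d ∈ D, d ^ n = 1 → d ∈ C)
    (hcard : Nat.card C * Nat.card C ≤ Nat.card D) {c : G} (hc : c ∈ C) : ∃ d ∈ D, d ^ n = c := by
  have : IsMulCommutative D := Subgroup.le_centralizer_iff_isMulCommutative.1 hD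
  let f : D →* G := D.subtype.comp (powMonoidHom n)
  have hrange : f.range ≤ C := by
    rintro _ ⟨d, rfl⟩
    exact hpow d d.2
  have hkerC : Nat.card f.ker ≤ Nat.card C :=
    Nat.card_le_card_of_injective (fun d => ⟨d, hker d d.1.2 d.2⟩)
      fun _ _ h => Subtype.ext (Subtype.ext (congrArg (Subtype.val : C → G) h))
  have hle : Nat.card C ≤ Nat.card f.range := by
    refine Nat.le_of_mul_le_mul_left ?_ (Nat.card_pos (α := C))
    refine hcard.trans ?_
    rw [← f.ker.card_mul_index, Subgroup.index_ker]
    exact Nat.mul_le_mul_right _ hkerC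
  obtain ⟨d, hd⟩ := (Subgroup.eq_of_le_of_card_ge hrange hle).ge hc
  exact ⟨d, d.2, hd⟩

theorem sq_mem_codegrees_or_exists_pow_eq (hG : IsPGroup p G)
    (hcl : commutator G ≤ Subgroup.center G) (hexp : ∀ g : G, g ^ p ∈ commutator G)
    (hcard : p < Nat.card (commutator G)) (hle : Nat.card G ≤ p ^ 5) :
    (p : ℂ) ^ 2 ∈ codegrees G ∨ ∃ D : Subgroup G, D.index ≤ p ∧ D ≤ Subgroup.centralizer D ∧
      ∀ h ∈ commutator G, ∃ d ∈ D, d ^ p = h := by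
  have hp : p.Prime := Fact.out
  obtain ⟨heq, hZ, hidx⟩ := commutator_eq_center_of_card_le hG hcl hcard hle
  obtain ⟨D, hDidx, hD⟩ := exists_le_centralizer_of_index_eq hG heq hZ hidx
  by_cases hker : ∀ d ∈ D, d ^ p = 1 → d ∈ commutator G
  · refine Or.inr ⟨D, hDidx.le, hD, fun h hh =>
      exists_pow_eq_of_le_centralizer hD (fun d _ => hexp d) hker ?_ hh⟩
    have hmul := (D.card_mul_index.trans (Subgroup.card_mul_index _).symm).trans
      (congrArg₂ _ hZ hidx)
    rw [hDidx, ← pow_add, pow_succ] at hmul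
    rw [heq, hZ, ← pow_add, Nat.eq_of_mul_eq_mul_right hp.pos hmul]
  · push Not at hker
    obtain ⟨d, hdD, hdp, hd⟩ := hker
    exact Or.inl (sq_mem_codegrees_of_pow_eq_one hG hcl
      (fun h => pow_eq_one_of_mem_commutator hcl fun g => hcl (hexp g)) hcard (heq ▸ hidx.le)
      hDidx.le hD hdD hd hdp)

end ClassTwoPGroups

section ThirdTerm

variable {G : Type*} [Group G]

theorem comap_le_centralizer_commutator {T : Subgroup G} [T.Normal]
    (hT : T ≤ Subgroup.center G) {n : ℕ} (hexp : ∀ t ∈ T, t ^ n = 1) {D : Subgroup (G ⧸ T)}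
    (hD : D ≤ Subgroup.centralizer D) (hpow : ∀ h ∈ commutator (G ⧸ T), ∃ d ∈ D, d ^ n = h) :
    D.comap (QuotientGroup.mk' T) ≤ Subgroup.centralizer (commutator G) := by
  intro e he
  refine Subgroup.mem_centralizer_iff.2 fun h hh => ?_
  obtain ⟨q, hdD, hq⟩ := hpow (h : G ⧸ T) (by
    rw [commutator_quotient]
    exact ⟨h, hh, rfl⟩)
  obtain ⟨d, rfl⟩ := QuotientGroup.mk_surjective q
  have hde : ⁅d, e⁆ ∈ T := commute_mk_iff.1 (Subgroup.mem_centralizer_iff.1 (hD he) d hdD)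
  have hdpow : Commute (d ^ n) e := by
    rw [← commutatorElement_eq_one_iff_commute,
      commutatorElement_pow_left (commute_of_mem_center (hT hde) d), hexp _ hde]
  have hcorr : (d ^ n)⁻¹ * h ∈ T := QuotientGroup.eq.1 hq
  rw [← mul_inv_cancel_left (d ^ n) h]
  exact hdpow.mul_left (commute_of_mem_center (hT hcorr) e).symm

theorem commutator_commutator_top_quotient (L : Subgroup G) [L.Normal] :
    ⁅commutator (G ⧸ L), (⊤ : Subgroup (G ⧸ L))⁆ =
      ⁅commutator G, (⊤ : Subgroup G)⁆.map (QuotientGroup.mk' L) := by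
  rw [Subgroup.map_commutator, commutator_quotient, ← MonoidHom.range_eq_map,
    MonoidHom.range_eq_top.2 (QuotientGroup.mk'_surjective L)]

theorem commutator_top_lt [Group.IsNilpotent G] {H : Subgroup G} [H.Normal]
    (hH : H ≠ ⊥) : ⁅H, (⊤ : Subgroup G)⁆ < H := by
  refine (Subgroup.commutator_le_left H ⊤).lt_of_ne fun heq => hH ?_
  have hle : ∀ n, H ≤ (⊤ : Subgroup G).lowerCentralSeries n := by
    intro n
    induction n with
    | zero => exact le_top
    | succ n ih =>
      rw [← heq]
      exact Subgroup.commutator_mono ih le_rfl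
  rw [← le_bot_iff, ← Subgroup.lowerCentralSeries_nilpotencyClass (G := G)]
  exact hle _

end ThirdTerm

section ClassThree

variable {p : ℕ} [Fact p.Prime] {G : Type*} [Group G] [Finite G]

theorem sq_mem_codegrees_or_relIndex_center_le (hG : IsPGroup p G)
    (hexp : ∀ g : G, g ^ p ∈ commutator G)
    (hcen : ⁅commutator G, (⊤ : Subgroup G)⁆ ≤ Subgroup.center G)
    (hcard : Nat.card (⁅commutator G, (⊤ : Subgroup G)⁆ : Subgroup G) = p)
    (hidx : ⁅commutator G, (⊤ : Subgroup G)⁆.index ≤ p ^ 5) :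
    (p : ℂ) ^ 2 ∈ codegrees G ∨ (Subgroup.center G).relIndex (commutator G) ≤ p := by
  set T := ⁅commutator G, (⊤ : Subgroup G)⁆
  have hQ : IsPGroup p (G ⧸ T) := hG.to_quotient T
  have hQcl : commutator (G ⧸ T) ≤ Subgroup.center (G ⧸ T) := by
    rw [commutator_quotient, Subgroup.map_le_iff_le_comap]
    exact fun h hh => mk_mem_center_iff.2 fun g =>
      Subgroup.commutator_mem_commutator hh (Subgroup.mem_top g)
  have hQexp : ∀ q : G ⧸ T, q ^ p ∈ commutator (G ⧸ T) := by
    rw [commutator_quotient]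
    exact QuotientGroup.mk_surjective.forall.2 fun g => ⟨g ^ p, hexp g, rfl⟩
  rcases le_or_gt (Nat.card (commutator (G ⧸ T))) p with hle | hlt
  · rw [commutator_quotient, card_map_mk'] at hle
    exact Or.inr ((Subgroup.relIndex_le_of_le_left hcen Subgroup.index_ne_zero_of_finite).trans hle)
  · rw [Subgroup.index_eq_card] at hidx
    refine (sq_mem_codegrees_or_exists_pow_eq hQ hQcl hQexp hlt hidx).imp
      (fun h => codegrees_subset_of_surjective (QuotientGroup.mk'_surjective T) h) ?_
    rintro ⟨D, hDidx, hD, hpow⟩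
    have hTexp : ∀ t ∈ T, t ^ p = 1 := fun t ht => by
      have := pow_card_eq_one' (x := (⟨t, ht⟩ : T))
      rw [hcard] at this
      exact congrArg Subtype.val this
    obtain ⟨g, hg⟩ := exists_sup_zpowers_eq_top hG (D := D.comap (QuotientGroup.mk' T))
      (by rwa [Subgroup.index_comap_of_surjective _ (QuotientGroup.mk'_surjective T)])
    exact (relIndex_center_le (comap_le_centralizer_commutator hcen hTexp hD hpow) hg fun b hb =>
      Subgroup.commutator_mem_commutator hb (Subgroup.mem_top g)).trans hcard.le

theorem sq_mem_codegrees_of_card_commutator_commutator_eq (hG : IsPGroup p G)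
    (hexp : ∀ g : G, g ^ p ∈ commutator G)
    (hcen : ⁅commutator G, (⊤ : Subgroup G)⁆ ≤ Subgroup.center G)
    (hcard : Nat.card (⁅commutator G, (⊤ : Subgroup G)⁆ : Subgroup G) = p)
    (hidx : ⁅commutator G, (⊤ : Subgroup G)⁆.index ≤ p ^ 5) : (p : ℂ) ^ 2 ∈ codegrees G := by
  refine (sq_mem_codegrees_or_relIndex_center_le hG hexp hcen hcard hidx).elim id fun hrel =>
    sq_mem_codegrees_of_relIndex_center_le hG hexp hcard.le hrel ?_
  rw [← Subgroup.commutator_top_right_eq_bot_iff_le_center, ← Subgroup.card_eq_one, hcard]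
  exact (Fact.out : p.Prime).ne_one

theorem theorem1_general (hG : IsPGroup p G) (hclass : 3 ≤ Group.nilpotencyClass G)
    (hidx : ((⊤ : Subgroup G).lowerCentralSeries 2).index ≤ p ^ 5) :
    (p : ℂ) ^ 2 ∈ codegrees G := by
  have := hG.isNilpotent
  have hne : (⊤ : Subgroup G).lowerCentralSeries 2 ≠ ⊥ := fun h =>
    hclass.not_gt <| Nat.lt_succ_of_le <|
      Subgroup.lowerCentralSeries_eq_bot_iff_nilpotencyClass_le.1 h
  rw [Subgroup.lowerCentralSeries_succ, Subgroup.top_lowerCentralSeries_one] at hne hidx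
  by_cases hexp : ∀ g : G, g ^ p ∈ commutator G
  swap
  · obtain ⟨g, hg⟩ := not_forall.1 hexp
    exact sq_mem_codegrees_of_pow_notMem_commutator hG hg
  set T := ⁅commutator G, (⊤ : Subgroup G)⁆
  have hlt : ⁅T, (⊤ : Subgroup G)⁆ < T := commutator_top_lt hne
  obtain ⟨L, hTL, hLT, hcard⟩ := exists_between_card_mul hG hlt
  have : L.Normal := by
    rw [← Subgroup.commutator_top_right_le_iff]
    exact (Subgroup.commutator_mono hLT le_rfl).trans hTL
  refine codegrees_subset_of_surjective (QuotientGroup.mk'_surjective L)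
    (sq_mem_codegrees_of_card_commutator_commutator_eq (hG.to_quotient L) ?_ ?_ ?_ ?_)
  · rw [commutator_quotient]
    exact QuotientGroup.mk_surjective.forall.2 fun g => ⟨g ^ p, hexp g, rfl⟩
  · rw [commutator_commutator_top_quotient, Subgroup.map_le_iff_le_comap]
    exact fun t ht => mk_mem_center_iff.2 fun g =>
      hTL (Subgroup.commutator_mem_commutator ht (Subgroup.mem_top g))
  · rw [commutator_commutator_top_quotient, card_map_mk']
    exact Nat.eq_of_mul_eq_mul_left Nat.card_pos ((card_mul_relIndex hLT).trans hcard.symm)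
  · rwa [commutator_commutator_top_quotient, index_map_mk'_eq hLT]

end ClassThree

section Coclass

variable {p : ℕ} [Fact p.Prime] {G : Type*} [Group G]

theorem le_nilpotencyClass_of_coclass_le {r k : ℕ} (hr : coclass p G ≤ r)
    (hcard : p ^ (r + k) ≤ Nat.card G) : k ≤ Group.nilpotencyClass G := by
  have hlog : r + k ≤ Nat.log p (Nat.card G) :=
    Nat.le_log_of_pow_le (Fact.out : p.Prime).one_lt hcard
  rw [coclass] at hr
  lia

variable [Finite G]

theorem pow_le_card_lowerCentralSeries (hG : IsPGroup p G) {m j : ℕ}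
    (h : m + j ≤ Group.nilpotencyClass G) :
    p ^ j ≤ Nat.card ((⊤ : Subgroup G).lowerCentralSeries m) := by
  have := hG.isNilpotent
  induction j generalizing m with
  | zero => exact Nat.card_pos
  | succ j ih =>
    have hne : (⊤ : Subgroup G).lowerCentralSeries m ≠ ⊥ := fun hbot => by
      have := Subgroup.lowerCentralSeries_eq_bot_iff_nilpotencyClass_le.1 hbot
      lia
    rw [pow_succ]
    exact (Nat.mul_le_mul_right p (ih (m := m + 1) (by lia))).trans
      (card_mul_le_of_lt hG (commutator_top_lt hne))

theorem index_lowerCentralSeries_le_of_coclass_le (hG : IsPGroup p G) {r m : ℕ}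
    (hr : coclass p G ≤ r) (hm : m ≤ Group.nilpotencyClass G) :
    ((⊤ : Subgroup G).lowerCentralSeries m).index ≤ p ^ (m + r) := by
  have hp : p.Prime := Fact.out
  obtain ⟨n, hn⟩ := IsPGroup.iff_card.1 hG
  obtain ⟨j, hj⟩ := Nat.exists_eq_add_of_le hm
  rw [coclass, hn, Nat.log_pow hp.one_lt] at hr
  refine Nat.le_of_mul_le_mul_left ?_ (pow_pos hp.pos j)
  calc p ^ j * ((⊤ : Subgroup G).lowerCentralSeries m).index
      ≤ Nat.card ((⊤ : Subgroup G).lowerCentralSeries m) *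
          ((⊤ : Subgroup G).lowerCentralSeries m).index :=
        Nat.mul_le_mul_right _ (pow_le_card_lowerCentralSeries hG hj.ge)
    _ = p ^ n := by rw [Subgroup.card_mul_index, hn]
    _ ≤ p ^ (j + (m + r)) := Nat.pow_le_pow_right hp.pos (by lia)
    _ = p ^ j * p ^ (m + r) := pow_add _ _ _

end Coclass

theorem theorem1 (p : ℕ) [Fact p.Prime] (G : Type*) [Group G] [Finite G] (hG : IsPGroup p G) :
    (coclass p G = 2 → p ^ 5 ≤ Nat.card G → (p : ℂ) ^ 2 ∈ codegrees G) ∧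
    (coclass p G = 3 → p ^ 6 ≤ Nat.card G → (p : ℂ) ^ 2 ∈ codegrees G) := by
  have key (hco : coclass p G ≤ 3) (hclass : 3 ≤ Group.nilpotencyClass G) :
      (p : ℂ) ^ 2 ∈ codegrees G :=
    theorem1_general hG hclass
      (index_lowerCentralSeries_le_of_coclass_le hG hco (Nat.le_of_succ_le hclass))
  exact ⟨fun hco hcard => key (by lia) (le_nilpotencyClass_of_coclass_le hco.le hcard),
    fun hco hcard => key hco.le (le_nilpotencyClass_of_coclass_le hco.le hcard)⟩
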